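/- Let $k$ be a field and let $A = \bigoplus_{n \geq 0} A_n$ be a finitely generated commutative $\mathbb{N}$-graded $k$-algebra (not necessarily generated in degree $1$) such that $\dim_k A_0 < \infty$ (for example $A_0 = k$). Assume that the Krull dimension of $A$ is positive (in particular $A \neq 0$). Then $\dim_{\mathrm{Krull}} A$ is finite, every $A_n$ is finite-dimensional over $k$, and the Hilbert function $\mathrm{HF}_A(n) = \dim_k A_n$ satisfies $$\mathrm{HF}_A(n) = O\bigl(n^{\dim_{\mathrm{Krull}} A - 1}\bigr) \quad\text{and}\quad \mathrm{HF}_A(n) \neq o\bigl(n^{\dim_{\mathrm{Krull}} A - 1}\bigr) \qquad (n \to \infty).$$ Moreover, $\mathrm{HF}_A$ is eventually quasi-polynomial: there are an integer $W \geq 1$ and polynomials $Q_0, \ldots, Q_{W-1} \in \mathbb{Q}[X]$ such that, for each $m \in \{0, \ldots, W-1\}$, $\mathrm{HF}_A(Wn+m) = Q_m(n)$ for all sufficiently large $n$, with $\deg Q_0 = \dim_{\mathrm{Krull}} A - 1$ and $\deg Q_m \leq \deg Q_0$ for all $m$ (where $\deg 0 = -\infty$). -/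

import Mathlib

open Filter Asymptotics

/-- The Hilbert function `n ↦ dim_k A_n` of a graded `k`-algebra `A = ⨁ A_n`. -/
noncomputable def hilbertFunction {k A : Type*} [Field k] [CommRing A] [Algebra k A]
    (𝒜 : ℕ → Submodule k A) (n : ℕ) : ℕ :=
  Module.finrank k (𝒜 n)

/-- The sharp big-O notation: `f(n) = O(n ^ ζ)` and `f(n) ≠ o(n ^ ζ)` as `n → ∞`. -/
def IsSharpBigO (f : ℕ → ℕ) (ζ : ℕ) : Prop :=
  (fun n : ℕ => (f n : ℝ)) =O[atTop] (fun n : ℕ => (n : ℝ) ^ ζ) ∧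
    ¬ (fun n : ℕ => (f n : ℝ)) =o[atTop] (fun n : ℕ => (n : ℝ) ^ ζ)

/-- An injective integral ring extension preserves the Krull dimension. -/
theorem ringKrullDim_eq_of_isIntegral_of_faithfulSMul {R S : Type*} [CommRing R] [CommRing S]
    [Algebra R S] [Algebra.IsIntegral R S] [FaithfulSMul R S] :
    ringKrullDim S = ringKrullDim R := by
  apply le_antisymm
  · exact Order.krullDim_le_of_strictMono (fun I => PrimeSpectrum.comap (algebraMap R S) I)
      (fun I J h => Ideal.IsIntegral.comap_lt_comap (R := R) (A := S) (I := I.asIdeal) h)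
  · refine iSup_le fun l => ?_
    obtain ⟨P, hP, hP'⟩ := Ideal.nonempty_primesOver (S := S) (l.head.asIdeal)
    obtain ⟨L, hL, -⟩ := Ideal.exists_ltSeries_of_hasGoingUp l P
    rw [← hL]
    exact Order.LTSeries.length_le_krullDim L

/-- Every rational polynomial is the forward difference of another one. -/
theorem Polynomial.exists_eval_add_one_sub_eval (p : Polynomial ℚ) :
    ∃ q : Polynomial ℚ, ∀ x : ℚ, q.eval (x + 1) - q.eval x = p.eval x := by
  induction p using Polynomial.induction_on' with
  | add p q hp hq =>
    obtain ⟨p', hp'⟩ := hp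
    obtain ⟨q', hq'⟩ := hq
    refine ⟨p' + q', fun x => ?_⟩
    rw [Polynomial.eval_add, Polynomial.eval_add, Polynomial.eval_add, ← hp', ← hq']
    ring
  | monomial n a =>
    refine ⟨Polynomial.C (a / (n + 1)) * Polynomial.bernoulli (n + 1), fun x => ?_⟩
    have h := Polynomial.bernoulli_eval_one_add (n + 1) x
    rw [add_comm x 1, Polynomial.eval_mul, Polynomial.eval_mul, h]
    simp only [Polynomial.eval_C, Polynomial.eval_monomial, Nat.add_sub_cancel, Nat.cast_add,
      Nat.cast_one]
    have : (n : ℚ) + 1 ≠ 0 := by positivity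
    field_simp
    ring

/-- A sequence whose forward difference is eventually polynomial is eventually polynomial. -/
theorem exists_polynomial_eventually_eq_of_sub {f : ℕ → ℚ} {p : Polynomial ℚ}
    (h : ∀ᶠ n : ℕ in atTop, f (n + 1) - f n = p.eval (n : ℚ)) :
    ∃ q : Polynomial ℚ, ∀ᶠ n : ℕ in atTop, f n = q.eval (n : ℚ) := by
  obtain ⟨q, hq⟩ := p.exists_eval_add_one_sub_eval
  obtain ⟨N, hN⟩ := eventually_atTop.1 h
  refine ⟨q + Polynomial.C (f N - q.eval (N : ℚ)), eventually_atTop.2 ⟨N, fun n hn => ?_⟩⟩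
  induction n, hn using Nat.le_induction with
  | base => simp
  | succ n hn ih =>
    have h1 := hN n hn
    have h2 := hq n
    simp only [Polynomial.eval_add, Polynomial.eval_C, Nat.cast_add, Nat.cast_one] at ih ⊢
    linarith

/-- Rank-nullity for the restriction of a linear map to a subspace. -/
theorem Submodule.finrank_map_add_finrank_inf_ker {k V V' : Type*} [Field k] [AddCommGroup V]
    [Module k V] [AddCommGroup V'] [Module k V'] (f : V →ₗ[k] V') (L : Submodule k V)
    [Module.Finite k L] :
    Module.finrank k (L.map f) + Module.finrank k (L ⊓ LinearMap.ker f : Submodule k V) =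
      Module.finrank k L := by
  have h := (f.domRestrict L).finrank_range_add_finrank_ker
  rw [LinearMap.range_domRestrict, LinearMap.ker_domRestrict] at h
  rw [← h]
  congr 1
  have e := (Submodule.equivMapOfInjective L.subtype L.injective_subtype
    ((LinearMap.ker f).comap L.subtype)).finrank_eq
  rw [Submodule.map_comap_subtype] at e
  exact e.symm

theorem Submodule.finrank_mul_le {k A : Type*} [Field k] [CommRing A] [Algebra k A]
    (M N : Submodule k A) [Module.Finite k M] [Module.Finite k N] :
    Module.finrank k (M * N : Submodule k A) ≤ Module.finrank k M * Module.finrank k N := by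
  rw [← Module.finrank_tensorProduct, ← Submodule.mulMap_range]
  exact LinearMap.finrank_range_le _

theorem Submodule.finrank_iSup_le {k V ι : Type*} [Field k] [AddCommGroup V] [Module k V]
    [Fintype ι] (M : ι → Submodule k V) [∀ i, Module.Finite k (M i)] :
    Module.finrank k (⨆ i, M i : Submodule k V) ≤ ∑ i, Module.finrank k (M i) := by
  classical
  rw [← Finset.sup_univ_eq_iSup]
  induction (Finset.univ : Finset ι) using Finset.induction_on with
  | empty => simp
  | insert a s ha ih =>
    rw [Finset.sup_insert, Finset.sum_insert ha]
    exact (Submodule.finrank_add_le_finrank_add_finrank _ _).trans (Nat.add_le_add_left ih _)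

/-- **Hilbert polynomials**, for a graded subquotient `⨁ L n / N n` of a vector space acted on by
finitely many commuting operators of degree one. Noetherianity is expressed by the hypothesis that
every stable graded submodule is generated in bounded degree. -/
theorem exists_hilbertPolynomial {k V ι : Type*} [Field k] [AddCommGroup V] [Module k V]
    (x : ι → Module.End k V) (hx : ∀ i j v, x i (x j v) = x j (x i v)) (s : Finset ι)
    (N L : ℕ → Submodule k V) (hNL : ∀ n, N n ≤ L n) (hfin : ∀ n, Module.Finite k (L n))
    (hN : ∀ i n, (N n).map (x i) ≤ N (n + 1)) (hL : ∀ i n, (L n).map (x i) ≤ L (n + 1))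
    (hnoeth : ∀ P : ℕ → Submodule k V, (∀ n, N n ≤ P n) → (∀ n, P n ≤ L n) →
      (∀ i ∈ s, ∀ n, (P n).map (x i) ≤ P (n + 1)) →
      ∀ᶠ n in atTop, P (n + 1) ≤ N (n + 1) ⊔ ⨆ i ∈ s, (P n).map (x i)) :
    ∃ p : Polynomial ℚ, ∀ᶠ n : ℕ in atTop,
      (Module.finrank k (L n) : ℚ) - Module.finrank k (N n) = p.eval (n : ℚ) := by
  classical
  induction s using Finset.induction_on generalizing N L with
  | empty =>
    obtain ⟨n₀, hn₀⟩ := eventually_atTop.1 (hnoeth L hNL (fun _ => le_rfl) fun i _ => hL i)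
    refine ⟨0, eventually_atTop.2 ⟨n₀ + 1, fun n hn => ?_⟩⟩
    obtain ⟨n, rfl⟩ := Nat.exists_eq_add_of_le' (Nat.le_of_add_left_le hn)
    have h := hn₀ n (by omega)
    have : L (n + 1) = N (n + 1) := le_antisymm (h.trans (by simp)) (hNL _)
    rw [this]
    simp
  | insert a s has ih =>
    set K : ℕ → Submodule k V := fun n => L n ⊓ (N (n + 1)).comap (x a) with hK
    set N' : ℕ → Submodule k V := fun n => N n ⊔ Nat.casesOn n ⊥ fun m => (L m).map (x a) with hN'
    have hN's : ∀ n, N' (n + 1) = N (n + 1) ⊔ (L n).map (x a) := fun n => rfl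
    have hNK : ∀ n, N n ≤ K n := fun n =>
      le_inf (hNL n) (Submodule.map_le_iff_le_comap.1 (hN a n))
    have hKL : ∀ n, K n ≤ L n := fun n => inf_le_left
    have hNN' : ∀ n, N n ≤ N' n := fun n => le_sup_left
    have hN'L : ∀ n, N' n ≤ L n := by
      rintro (_ | n)
      · simpa [hN'] using hNL 0
      · exact sup_le (hNL _) (hL a n)
    have hKfin : ∀ n, Module.Finite k (K n) := fun n =>
      Submodule.finiteDimensional_of_le (hKL n)
    obtain ⟨p, hp⟩ := ih N K hNK hKfin hN
      (by
        rintro i n _ ⟨v, ⟨hv, hv'⟩, rfl⟩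
        refine ⟨hL i n ⟨v, hv, rfl⟩, ?_⟩
        change x a (x i v) ∈ N (n + 1 + 1)
        rw [hx]
        exact hN i _ ⟨_, hv', rfl⟩)
      (by
        intro P h1 h2 h3
        have hxa : ∀ n, (P n).map (x a) ≤ N (n + 1) := fun n =>
          Submodule.map_le_iff_le_comap.2 ((h2 n).trans inf_le_right)
        refine (hnoeth P h1 (fun n => (h2 n).trans (hKL n)) ?_).mono fun n hn => ?_
        · intro i hi n
          rcases Finset.mem_insert.1 hi with rfl | hi
          · exact (hxa n).trans (h1 _)
          · exact h3 i hi n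
        · rw [Finset.iSup_insert] at hn
          exact hn.trans (sup_le le_sup_left (sup_le ((hxa n).trans le_sup_left) le_sup_right)))
    obtain ⟨q, hq⟩ := ih N' L hN'L hfin
      (by
        rintro i (_ | n)
        · simpa [hN'] using (hN i 0).trans le_sup_left
        · rw [hN's, hN's, Submodule.map_sup]
          refine sup_le_sup (hN i _) ?_
          rintro _ ⟨_, ⟨v, hv, rfl⟩, rfl⟩
          exact ⟨x i v, hL i n ⟨v, hv, rfl⟩, hx _ _ _⟩)
      hL
      (by
        intro P h1 h2 h3
        have hxa : ∀ n, (P n).map (x a) ≤ N' (n + 1) := fun n =>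
          (Submodule.map_mono (h2 n)).trans le_sup_right
        refine (hnoeth P (fun n => (hNN' n).trans (h1 n)) h2 ?_).mono fun n hn => ?_
        · intro i hi n
          rcases Finset.mem_insert.1 hi with rfl | hi
          · exact (hxa n).trans (h1 _)
          · exact h3 i hi n
        · rw [Finset.iSup_insert] at hn
          exact hn.trans (sup_le ((hNN' _).trans le_sup_left)
            (sup_le ((hxa n).trans le_sup_left) le_sup_right)))
    have hdim : ∀ n, (Module.finrank k (L n) : ℚ) - Module.finrank k (K n) =
        Module.finrank k (N' (n + 1)) - Module.finrank k (N (n + 1)) := by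
      intro n
      have := hfin n
      have : Module.Finite k (N' (n + 1)) :=
        have := hfin (n + 1)
        Submodule.finiteDimensional_of_le (hN'L (n + 1))
      have e1 := Submodule.finrank_map_add_finrank_inf_ker ((N (n + 1)).mkQ ∘ₗ x a) (L n)
      have e2 := Submodule.finrank_map_add_finrank_inf_ker (N (n + 1)).mkQ (N' (n + 1))
      rw [LinearMap.ker_comp, Submodule.ker_mkQ, Submodule.map_comp] at e1
      rw [Submodule.ker_mkQ, inf_eq_right.2 (hNN' _), hN's, Submodule.map_sup,
        Submodule.mkQ_map_self, bot_sup_eq, ← hN's] at e2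
      rw [show L n ⊓ (N (n + 1)).comap (x a) = K n from rfl] at e1
      have e1' : (_ : ℚ) = _ := congrArg (Nat.cast (R := ℚ)) e1
      have e2' : (_ : ℚ) = _ := congrArg (Nat.cast (R := ℚ)) e2
      push_cast at e1' e2'
      linarith
    refine exists_polynomial_eventually_eq_of_sub
      (p := q.comp (Polynomial.X + 1) - p) ?_
    filter_upwards [hp, (tendsto_add_atTop_nat 1).eventually hq] with n h1 h2
    have := hdim n
    simp only [Polynomial.eval_sub, Polynomial.eval_comp, Polynomial.eval_add, Polynomial.eval_X,
      Polynomial.eval_one]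
    push_cast at h2
    rw [← h1, ← h2]
    linarith

section Graded

variable {k A : Type*} [Field k] [CommRing A] [Algebra k A] (𝒜 : ℕ → Submodule k A)
  [GradedAlgebra 𝒜]

theorem GradedAlgebra.proj_of_mem {n : ℕ} {y : A} (hy : y ∈ 𝒜 n) :
    GradedAlgebra.proj 𝒜 n y = y := by
  rw [GradedAlgebra.proj_apply, DirectSum.decompose_of_mem_same 𝒜 hy]

theorem GradedAlgebra.proj_of_mem_ne {m n : ℕ} {y : A} (hy : y ∈ 𝒜 m) (h : m ≠ n) :
    GradedAlgebra.proj 𝒜 n y = 0 := by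
  rw [GradedAlgebra.proj_apply, DirectSum.decompose_of_mem_ne 𝒜 hy h]

theorem GradedAlgebra.proj_mem (n : ℕ) (y : A) : GradedAlgebra.proj 𝒜 n y ∈ 𝒜 n := by
  rw [GradedAlgebra.proj_apply]
  exact SetLike.coe_mem _

theorem GradedAlgebra.proj_mul_of_mem {i : ℕ} {a : A} (ha : a ∈ 𝒜 i) (n : ℕ) (y : A) :
    GradedAlgebra.proj 𝒜 n (a * y) = if i ≤ n then a * GradedAlgebra.proj 𝒜 (n - i) y else 0 := by
  simp only [GradedAlgebra.proj_apply]
  exact DirectSum.coe_decompose_mul_of_left_mem 𝒜 n ha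

theorem GradedAlgebra.isScalarTower_grade_zero : IsScalarTower k (𝒜 0) A :=
  ⟨fun r x y => by
    rw [Algebra.smul_def x y, Algebra.smul_def (r • x) y]
    exact smul_mul_assoc r (x : A) y⟩

/-- A graded algebra of finite type is generated over its degree zero part by finitely many
homogeneous elements of positive degree. -/
theorem exists_finset_pos_degree_adjoin_eq_top (hfg : Algebra.FiniteType k A) :
    ∃ (s : Finset A) (d : A → ℕ), (∀ a ∈ s, 0 < d a ∧ a ∈ 𝒜 (d a)) ∧
      Algebra.adjoin (𝒜 0) (s : Set A) = ⊤ := by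
  have := GradedAlgebra.isScalarTower_grade_zero 𝒜
  have : Algebra.FiniteType (𝒜 0) A := Algebra.FiniteType.of_restrictScalars_finiteType k (𝒜 0) A
  obtain ⟨s, hs, hs'⟩ := GradedAlgebra.exists_finset_adjoin_eq_top_and_homogeneous_ne_zero 𝒜
  choose! d hd hd' using hs'
  exact ⟨s, d, fun a ha => ⟨Nat.pos_of_ne_zero (hd a ha), hd' a ha⟩, hs⟩

variable {𝒜} {s : Finset A} {d : A → ℕ} (hs : ∀ a ∈ s, 0 < d a ∧ a ∈ 𝒜 (d a))
  (hadj : Algebra.adjoin (𝒜 0) (s : Set A) = ⊤)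

include hadj in
theorem exists_sub_mem_span_of_adjoin_eq_top (y : A) :
    ∃ r ∈ 𝒜 0, y - r ∈ Ideal.span (s : Set A) := by
  have hy : y ∈ Algebra.adjoin (𝒜 0) (s : Set A) := hadj ▸ Algebra.mem_top
  induction hy using Algebra.adjoin_induction with
  | mem x hx => exact ⟨0, zero_mem _, by simpa using Ideal.subset_span hx⟩
  | algebraMap r => exact ⟨r, r.2, by
      rw [show algebraMap (𝒜 0) A r = (r : A) from rfl, sub_self]; exact zero_mem _⟩
  | add x y _ _ hx hy =>
    obtain ⟨r, hr, hr'⟩ := hx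
    obtain ⟨t, ht, ht'⟩ := hy
    exact ⟨r + t, add_mem hr ht, by rw [add_sub_add_comm]; exact add_mem hr' ht'⟩
  | mul x y _ _ hx hy =>
    obtain ⟨r, hr, hr'⟩ := hx
    obtain ⟨t, ht, ht'⟩ := hy
    refine ⟨r * t, by simpa using SetLike.mul_mem_graded hr ht, ?_⟩
    rw [show x * y - r * t = y * (x - r) + r * (y - t) by ring]
    exact add_mem (Ideal.mul_mem_left _ _ hr') (Ideal.mul_mem_left _ _ ht')

include hs hadj in
/-- A homogeneous element of positive degree is a homogeneous combination of the generators. -/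
theorem exists_eq_sum_mul_of_mem_graded {n : ℕ} (hn : 0 < n) {y : A} (hy : y ∈ 𝒜 n) :
    ∃ c : A → A, (∀ a, c a ∈ 𝒜 (n - d a)) ∧ y = ∑ a ∈ s with d a ≤ n, a * c a := by
  obtain ⟨r, hr, h⟩ := exists_sub_mem_span_of_adjoin_eq_top hadj y
  obtain ⟨c, -, hc⟩ := Submodule.mem_span_finset.1 h
  refine ⟨fun a => GradedAlgebra.proj 𝒜 (n - d a) (c a), fun a => GradedAlgebra.proj_mem _ _ _, ?_⟩
  have h1 := congrArg (GradedAlgebra.proj 𝒜 n) hc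
  rw [map_sub, GradedAlgebra.proj_of_mem 𝒜 hy, GradedAlgebra.proj_of_mem_ne 𝒜 hr hn.ne, sub_zero,
    map_sum] at h1
  rw [← h1, Finset.sum_filter]
  refine Finset.sum_congr rfl fun a ha => ?_
  rw [smul_eq_mul, mul_comm, GradedAlgebra.proj_mul_of_mem 𝒜 (hs a ha).2]

include hs hadj in
theorem finite_graded_of_adjoin_eq_top (h0 : Module.Finite k (𝒜 0)) (n : ℕ) :
    Module.Finite k (𝒜 n) := by
  induction n using Nat.strong_induction_on with
  | _ n ih =>
    rcases Nat.eq_zero_or_pos n with rfl | hn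
    · exact h0
    have hle : 𝒜 n ≤ (s.filter (d · ≤ n)).sup
        fun a => (𝒜 (n - d a)).map (LinearMap.mulLeft k a) := by
      intro y hy
      obtain ⟨c, hc, rfl⟩ := exists_eq_sum_mul_of_mem_graded hs hadj hn hy
      refine sum_mem fun a ha => ?_
      exact Finset.le_sup (f := fun a => (𝒜 (n - d a)).map (LinearMap.mulLeft k a)) ha
        ⟨c a, hc a, rfl⟩
    have : ∀ a : (s.filter (d · ≤ n)),
        Module.Finite k ((𝒜 (n - d a)).map (LinearMap.mulLeft k (a : A))) := by
      rintro ⟨a, ha⟩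
      have h1 := (hs a (Finset.mem_filter.1 ha).1).1
      have := ih (n - d a) (by omega)
      infer_instance
    have hfin : Module.Finite k (⨆ a : (s.filter (d · ≤ n)),
        (𝒜 (n - d a)).map (LinearMap.mulLeft k (a : A)) : Submodule k A) := by
      infer_instance
    rw [Finset.sup_eq_iSup, ← iSup_subtype (p := (· ∈ s.filter (d · ≤ n)))
      (f := fun a => (𝒜 (n - d a.1)).map (LinearMap.mulLeft k a.1))] at hle
    exact Submodule.finiteDimensional_of_le hle

include hs in
theorem pow_prod_div_mem_graded {a : A} (ha : a ∈ s) :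
    a ^ ((∏ a ∈ s, d a) / d a) ∈ 𝒜 (∏ a ∈ s, d a) := by
  have := SetLike.pow_mem_graded ((∏ a ∈ s, d a) / d a) (hs a ha).2
  rwa [smul_eq_mul, Nat.div_mul_cancel (Finset.dvd_prod_of_mem d ha)] at this

/-- The algebra is integral, hence Noetherian, over the subalgebra generated by powers of the
generators of a common degree. -/
theorem isNoetherian_adjoin_image_pow (hfg : Algebra.FiniteType k A)
    (h0 : Module.Finite k (𝒜 0)) (hadj : Algebra.adjoin (𝒜 0) (s : Set A) = ⊤)
    (e : A → ℕ) (he : ∀ a ∈ s, 0 < e a) :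
    IsNoetherian (Algebra.adjoin k ((fun a => a ^ e a) '' (s : Set A))) A := by
  classical
  set B := Algebra.adjoin k ((fun a => a ^ e a) '' (s : Set A)) with hB
  have hint : Algebra.IsIntegral B A := by
    refine ⟨fun y => ?_⟩
    have hy : y ∈ Algebra.adjoin (𝒜 0) (s : Set A) := hadj ▸ Algebra.mem_top
    induction hy using Algebra.adjoin_induction with
    | mem x hx =>
      refine IsIntegral.of_pow (he x hx) ?_
      exact isIntegral_algebraMap (x := (⟨x ^ e x, Algebra.subset_adjoin ⟨x, hx, rfl⟩⟩ : B))
    | algebraMap r =>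
      have := GradedAlgebra.isScalarTower_grade_zero 𝒜
      have h1 : IsIntegral k r := Algebra.IsIntegral.isIntegral r
      have h2 : IsIntegral k (algebraMap (𝒜 0) A r) := h1.algebraMap
      exact h2.tower_top
    | add x y _ _ hx hy => exact hx.add hy
    | mul x y _ _ hx hy => exact hx.mul hy
  have : Algebra.FiniteType B A := Algebra.FiniteType.of_restrictScalars_finiteType k B A
  have : Module.Finite B A := Algebra.IsIntegral.finite
  have : IsNoetherianRing B := by
    rw [hB, ← Finset.coe_image]
    have := (Subalgebra.fg_iff_finiteType _).1
      (Subalgebra.fg_adjoin_finset (R := k) (s.image fun a => a ^ e a))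
    exact Algebra.FiniteType.isNoetherianRing k _
  exact isNoetherian_of_isNoetherianRing_of_finite B A

end Graded

section Veronese

variable {k A ι : Type*} [Field k] [CommRing A] [Algebra k A] (𝒜 : ℕ → Submodule k A)
  [GradedAlgebra 𝒜] {b : ι → A} {W m : ℕ}

/-- Stable graded submodules of `⨁ 𝒜 (W * n + m)` are generated in bounded degree. -/
theorem eventually_le_iSup_map_mulLeft (hb : ∀ i, b i ∈ 𝒜 W) (hW : m < W)
    [IsNoetherian (Algebra.adjoin k (Set.range b)) A] (P : ℕ → Submodule k A)
    (hP : ∀ n, P n ≤ 𝒜 (W * n + m))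
    (hstab : ∀ i n, (P n).map (LinearMap.mulLeft k (b i)) ≤ P (n + 1)) :
    ∀ᶠ n in atTop, P (n + 1) ≤ ⨆ i, (P n).map (LinearMap.mulLeft k (b i)) := by
  have hW0 : 0 < W := by omega
  let B := Algebra.adjoin k (Set.range b)
  let M : ℕ →o Submodule B A :=
    ⟨fun j => Submodule.span B {y | ∃ i ≤ j, y ∈ P i}, fun i j hij =>
      Submodule.span_mono fun y ⟨l, hl, hy⟩ => ⟨l, hl.trans hij, hy⟩⟩
  obtain ⟨n₀, hn₀⟩ := monotone_stabilizes_iff_noetherian.2 ‹IsNoetherian B A› M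
  refine eventually_atTop.2 ⟨n₀, fun n hn y hy => ?_⟩
  have hyM : y ∈ M n₀ := by
    rw [hn₀ (n + 1) (by omega)]
    exact Submodule.subset_span ⟨n + 1, le_rfl, hy⟩
  let Q : Submodule k A :=
    ⨅ l, ((P l).comap (GradedAlgebra.proj 𝒜 (W * l + m)) ⊓ ⨅ (_ : n < l),
      (⨆ i, (P (l - 1)).map (LinearMap.mulLeft k (b i))).comap (GradedAlgebra.proj 𝒜 (W * l + m)))
  have hQ : ∀ z, z ∈ Q ↔ ∀ l, GradedAlgebra.proj 𝒜 (W * l + m) z ∈ P l ∧ (n < l →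
      GradedAlgebra.proj 𝒜 (W * l + m) z ∈
        ⨆ i, (P (l - 1)).map (LinearMap.mulLeft k (b i))) := by
    intro z
    simp only [Q, Submodule.mem_iInf, Submodule.mem_inf, Submodule.mem_comap]
  have hQgen : ∀ i ≤ n, P i ≤ Q := by
    intro i hi z hz
    rw [hQ]
    intro l
    rcases eq_or_ne i l with rfl | hil
    · rw [GradedAlgebra.proj_of_mem 𝒜 (hP i hz)]
      exact ⟨hz, fun h => absurd h (by omega)⟩
    · rw [GradedAlgebra.proj_of_mem_ne 𝒜 (hP i hz)
        (fun h => hil (Nat.eq_of_mul_eq_mul_left hW0 (Nat.add_right_cancel h)))]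
      exact ⟨zero_mem _, fun _ => zero_mem _⟩
  have hQmul : ∀ i, ∀ z ∈ Q, b i * z ∈ Q := by
    intro i z hz
    rw [hQ] at hz ⊢
    intro l
    rw [GradedAlgebra.proj_mul_of_mem 𝒜 (hb i)]
    rcases l with _ | l
    · rw [if_neg (by simpa using hW)]
      exact ⟨zero_mem _, fun _ => zero_mem _⟩
    · rw [if_pos (by rw [mul_add]; omega), show W * (l + 1) + m - W = W * l + m by
        rw [mul_add]; omega]
      exact ⟨hstab i l ⟨_, (hz l).1, rfl⟩, fun _ =>
        Submodule.mem_iSup_of_mem i ⟨_, (hz l).1, rfl⟩⟩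
  have hQB : ∀ r ∈ B, ∀ z ∈ Q, r * z ∈ Q := by
    intro r hr
    induction hr using Algebra.adjoin_induction with
    | mem x hx =>
      obtain ⟨i, rfl⟩ := hx
      exact hQmul i
    | algebraMap r =>
      intro z hz
      rw [← Algebra.smul_def]
      exact Q.smul_mem r hz
    | add x y _ _ hx hy =>
      intro z hz
      rw [add_mul]
      exact add_mem (hx z hz) (hy z hz)
    | mul x y _ _ hx hy =>
      intro z hz
      rw [mul_assoc]
      exact hx _ (hy z hz)
  have hMQ : ∀ z ∈ M n₀, z ∈ Q := by
    intro z hz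
    induction hz using Submodule.span_induction with
    | mem z hz =>
      obtain ⟨i, hi, hz⟩ := hz
      exact hQgen i (hi.trans hn) hz
    | zero => exact zero_mem _
    | add x y _ _ hx hy => exact add_mem hx hy
    | smul r x _ hx => exact hQB r r.2 x hx
  have := ((hQ y).1 (hMQ y hyM) (n + 1)).2 (by omega)
  rwa [GradedAlgebra.proj_of_mem 𝒜 (hP _ hy)] at this

theorem map_mulLeft_graded_le (hb : ∀ i, b i ∈ 𝒜 W) (i : ι) (n : ℕ) :
    (𝒜 (W * n + m)).map (LinearMap.mulLeft k (b i)) ≤ 𝒜 (W * (n + 1) + m) := by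
  rintro _ ⟨v, hv, rfl⟩
  have := SetLike.mul_mem_graded (hb i) hv
  rwa [show W + (W * n + m) = W * (n + 1) + m by ring] at this

/-- The Hilbert function is polynomial along arithmetic progressions of difference `W`. -/
theorem exists_polynomial_hilbertFunction [Fintype ι] (hb : ∀ i, b i ∈ 𝒜 W) (hW : m < W)
    [IsNoetherian (Algebra.adjoin k (Set.range b)) A] (hfin : ∀ n, Module.Finite k (𝒜 n)) :
    ∃ p : Polynomial ℚ, ∀ᶠ n : ℕ in atTop,
      (hilbertFunction 𝒜 (W * n + m) : ℚ) = p.eval (n : ℚ) := by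
  obtain ⟨p, hp⟩ := exists_hilbertPolynomial (fun i => LinearMap.mulLeft k (b i))
    (fun i j v => by simp [mul_left_comm]) Finset.univ (fun _ => ⊥)
    (fun n => 𝒜 (W * n + m)) (fun _ => bot_le) (fun n => hfin _) (fun i n => by simp)
    (map_mulLeft_graded_le 𝒜 hb)
    (fun P _ (h2 : ∀ n, P n ≤ 𝒜 (W * n + m)) h3 => (eventually_le_iSup_map_mulLeft 𝒜 hb hW P h2
      (fun i => h3 i (Finset.mem_univ i))).mono fun n hn => by simpa using hn)
  exact ⟨p, hp.mono fun n hn => by simpa [hilbertFunction] using hn⟩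

/-- The Hilbert function on a residue class is dominated by the one on multiples of `W`. -/
theorem exists_hilbertFunction_le_mul (hb : ∀ i, b i ∈ 𝒜 W) (hW : m < W)
    [IsNoetherian (Algebra.adjoin k (Set.range b)) A] (hfin : ∀ n, Module.Finite k (𝒜 n)) :
    ∃ C n₀ : ℕ, ∀ t, hilbertFunction 𝒜 (W * (n₀ + t) + m) ≤ C * hilbertFunction 𝒜 (W * t) := by
  obtain ⟨n₀, hn₀⟩ := eventually_atTop.1 (eventually_le_iSup_map_mulLeft 𝒜 hb hW
    (fun n => 𝒜 (W * n + m)) (fun _ => le_rfl) (map_mulLeft_graded_le 𝒜 hb))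
  have key : ∀ t, 𝒜 (W * (n₀ + t) + m) ≤ 𝒜 (W * n₀ + m) * 𝒜 (W * t) := by
    intro t
    induction t with
    | zero =>
      intro y hy
      simpa using Submodule.mul_mem_mul hy (SetLike.one_mem_graded 𝒜)
    | succ t ih =>
      refine (hn₀ (n₀ + t) (by omega)).trans (iSup_le fun i => ?_)
      refine (Submodule.map_mono ih).trans ?_
      rw [Submodule.map_le_iff_le_comap, Submodule.mul_le]
      intro u hu v hv
      change b i * (u * v) ∈ 𝒜 (W * n₀ + m) * 𝒜 (W * (t + 1))
      rw [mul_left_comm]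
      refine Submodule.mul_mem_mul hu ?_
      have := SetLike.mul_mem_graded (hb i) hv
      rwa [show W + W * t = W * (t + 1) by ring] at this
  refine ⟨hilbertFunction 𝒜 (W * n₀ + m), n₀, fun t => ?_⟩
  have := hfin (W * n₀ + m)
  have := hfin (W * t)
  have : Module.Finite k (𝒜 (W * n₀ + m) * 𝒜 (W * t) : Submodule k A) :=
    Module.Finite.iff_fg.2 ((Module.Finite.iff_fg.1 (hfin _)).mul (Module.Finite.iff_fg.1 (hfin _)))
  exact (Submodule.finrank_mono (key t)).trans (Submodule.finrank_mul_le _ _)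

end Veronese

section Growth

variable {k A : Type*} [Field k] [CommRing A] [Algebra k A] (𝒜 : ℕ → Submodule k A)

/-- The subspace of elements whose homogeneous components have degree less than `n`. -/
def gradedDegreeLT (n : ℕ) : Submodule k A :=
  ⨆ i : Fin n, 𝒜 i

theorem graded_le_gradedDegreeLT {i n : ℕ} (h : i < n) : 𝒜 i ≤ gradedDegreeLT 𝒜 n :=
  le_iSup (fun i : Fin n => 𝒜 i) ⟨i, h⟩

theorem gradedDegreeLT_mono {m n : ℕ} (h : m ≤ n) : gradedDegreeLT 𝒜 m ≤ gradedDegreeLT 𝒜 n :=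
  iSup_le fun i => graded_le_gradedDegreeLT 𝒜 (i.2.trans_le h)

variable {𝒜} in
theorem finite_gradedDegreeLT (hfin : ∀ n, Module.Finite k (𝒜 n)) (n : ℕ) :
    Module.Finite k (gradedDegreeLT 𝒜 n) := by
  unfold gradedDegreeLT
  infer_instance

variable [GradedAlgebra 𝒜]

theorem proj_eq_zero_of_mem_gradedDegreeLT {n : ℕ} {y : A} (hy : y ∈ gradedDegreeLT 𝒜 n) :
    GradedAlgebra.proj 𝒜 n y = 0 := by
  have : gradedDegreeLT 𝒜 n ≤ LinearMap.ker (GradedAlgebra.proj 𝒜 n) :=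
    iSup_le fun i z hz => GradedAlgebra.proj_of_mem_ne 𝒜 hz i.2.ne
  exact this hy

theorem exists_mem_gradedDegreeLT (y : A) : ∃ n, y ∈ gradedDegreeLT 𝒜 n := by
  classical
  refine ⟨(DirectSum.decompose 𝒜 y).support.sup id + 1, ?_⟩
  rw [← DirectSum.sum_support_decompose 𝒜 y]
  refine sum_mem fun i hi => ?_
  refine graded_le_gradedDegreeLT 𝒜 ?_ (SetLike.coe_mem _)
  have := Finset.le_sup (f := id) hi
  rw [DirectSum.sum_support_decompose 𝒜 y]
  exact Nat.lt_succ_of_le this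

theorem mul_mem_gradedDegreeLT {m n : ℕ} {x y : A} (hx : x ∈ gradedDegreeLT 𝒜 (m + 1))
    (hy : y ∈ gradedDegreeLT 𝒜 (n + 1)) : x * y ∈ gradedDegreeLT 𝒜 (m + n + 1) := by
  have h : gradedDegreeLT 𝒜 (m + 1) * gradedDegreeLT 𝒜 (n + 1) ≤
      gradedDegreeLT 𝒜 (m + n + 1) := by
    rw [gradedDegreeLT, gradedDegreeLT, Submodule.iSup_mul]
    refine iSup_le fun i => ?_
    rw [Submodule.mul_iSup]
    refine iSup_le fun j => Submodule.mul_le.2 fun u hu v hv => ?_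
    exact graded_le_gradedDegreeLT 𝒜 (by omega) (SetLike.mul_mem_graded hu hv)
  exact h (Submodule.mul_mem_mul hx hy)

theorem pow_mem_gradedDegreeLT {m : ℕ} {x : A} (hx : x ∈ gradedDegreeLT 𝒜 (m + 1)) (e : ℕ) :
    x ^ e ∈ gradedDegreeLT 𝒜 (m * e + 1) := by
  induction e with
  | zero =>
    rw [pow_zero]
    exact graded_le_gradedDegreeLT 𝒜 (by omega) (SetLike.one_mem_graded 𝒜)
  | succ e ih =>
    rw [pow_succ, mul_add, mul_one]
    exact mul_mem_gradedDegreeLT 𝒜 ih hx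

theorem prod_mem_gradedDegreeLT {ι : Type*} (s : Finset ι) {m : ℕ} {x : ι → A}
    (hx : ∀ i ∈ s, x i ∈ gradedDegreeLT 𝒜 (m + 1)) :
    ∏ i ∈ s, x i ∈ gradedDegreeLT 𝒜 (m * s.card + 1) := by
  classical
  induction s using Finset.induction_on with
  | empty =>
    rw [Finset.prod_empty]
    exact graded_le_gradedDegreeLT 𝒜 (by omega) (SetLike.one_mem_graded 𝒜)
  | insert a s ha ih =>
    rw [Finset.prod_insert ha, Finset.card_insert_of_notMem ha, mul_comm m, add_mul, one_mul,
      add_comm _ m, mul_comm _ m]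
    exact mul_mem_gradedDegreeLT 𝒜 (hx a (Finset.mem_insert_self _ _))
      (ih fun i hi => hx i (Finset.mem_insert_of_mem hi))

theorem finrank_gradedDegreeLT (hfin : ∀ n, Module.Finite k (𝒜 n)) (n : ℕ) :
    Module.finrank k (gradedDegreeLT 𝒜 n) = ∑ i ∈ Finset.range n, hilbertFunction 𝒜 i := by
  induction n with
  | zero =>
    rw [gradedDegreeLT, iSup_of_empty, finrank_bot, Finset.sum_range_zero]
  | succ n ih =>
    have h := finite_gradedDegreeLT hfin n
    have h' := hfin n
    have hsup : gradedDegreeLT 𝒜 (n + 1) = gradedDegreeLT 𝒜 n ⊔ 𝒜 n := by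
      refine le_antisymm (iSup_le fun i => ?_)
        (sup_le (gradedDegreeLT_mono 𝒜 n.le_succ) (graded_le_gradedDegreeLT 𝒜 n.lt_succ_self))
      rcases Nat.lt_succ_iff_lt_or_eq.1 i.2 with hi | hi
      · exact (graded_le_gradedDegreeLT 𝒜 hi).trans le_sup_left
      · rw [hi]
        exact le_sup_right
    have hinf : gradedDegreeLT 𝒜 n ⊓ 𝒜 n = ⊥ := by
      refine (Submodule.eq_bot_iff _).2 fun y hy => ?_
      rw [← GradedAlgebra.proj_of_mem 𝒜 hy.2, proj_eq_zero_of_mem_gradedDegreeLT 𝒜 hy.1]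
    have := Submodule.finrank_sup_add_finrank_inf_eq (gradedDegreeLT 𝒜 n) (𝒜 n)
    rw [hinf, finrank_bot, add_zero, ← hsup, ih] at this
    rw [this, Finset.sum_range_succ, hilbertFunction]

theorem MvPolynomial.finrank_restrictDegree (k : Type*) [Field k] (r n : ℕ) :
    Module.finrank k (MvPolynomial.restrictDegree (Fin r) k n) = (n + 1) ^ r := by
  have e : {m : Fin r →₀ ℕ | ∀ i, m i ≤ n} ≃ (Fin r → Fin (n + 1)) :=
    { toFun := fun m i => ⟨m.1 i, Nat.lt_succ_of_le (m.2 i)⟩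
      invFun := fun f => ⟨Finsupp.equivFunOnFinite.symm fun i => (f i : ℕ), fun i =>
        Nat.le_of_lt_succ (f i).2⟩
      left_inv := fun m => by ext i; rfl
      right_inv := fun f => by ext i; rfl }
  rw [MvPolynomial.restrictDegree, Module.finrank_eq_nat_card_basis
    (MvPolynomial.basisRestrictSupport k _), Nat.card_congr e]
  simp

theorem MvPolynomial.mul_mem_restrictDegree {k σ : Type*} [Field k] {m n : ℕ}
    {p q : MvPolynomial σ k} (hp : p ∈ MvPolynomial.restrictDegree σ k m)
    (hq : q ∈ MvPolynomial.restrictDegree σ k n) :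
    p * q ∈ MvPolynomial.restrictDegree σ k (m + n) := by
  classical
  rw [MvPolynomial.mem_restrictDegree] at *
  intro s hs i
  obtain ⟨u, hu, v, hv, rfl⟩ := Finset.mem_add.1 (MvPolynomial.support_mul p q hs)
  exact Nat.add_le_add (hp u hu i) (hq v hv i)

theorem MvPolynomial.restrictDegree_mono {k σ : Type*} [Field k] {m n : ℕ} (h : m ≤ n) :
    MvPolynomial.restrictDegree σ k m ≤ MvPolynomial.restrictDegree σ k n :=
  MvPolynomial.restrictSupport_mono _ fun _ hs i => (hs i).trans h

theorem MvPolynomial.exists_mem_restrictDegree {k σ : Type*} [Field k] (p : MvPolynomial σ k) :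
    ∃ n, p ∈ MvPolynomial.restrictDegree σ k n :=
  ⟨p.totalDegree, MvPolynomial.restrictTotalDegree_le_restrictDegree _ _ _
    ((MvPolynomial.mem_restrictTotalDegree _ _ _).2 le_rfl)⟩

/-- A polynomial subalgebra on `r` variables forces growth of order at least `r`. -/
theorem exists_pow_le_sum_hilbertFunction {r : ℕ} (g : MvPolynomial (Fin r) k →ₐ[k] A)
    (hg : Function.Injective g) (hfin : ∀ n, Module.Finite k (𝒜 n)) :
    ∃ c : ℕ, ∀ n : ℕ, (n + 1) ^ r ≤ ∑ i ∈ Finset.range (c * n + 1), hilbertFunction 𝒜 i := by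
  choose c hc using fun i => exists_mem_gradedDegreeLT 𝒜 (g (MvPolynomial.X i))
  have hc' : ∀ i, g (MvPolynomial.X i) ∈ gradedDegreeLT 𝒜 ((∑ i, c i) + 1) := fun i =>
    gradedDegreeLT_mono 𝒜 ((Finset.single_le_sum (fun _ _ => Nat.zero_le _)
      (Finset.mem_univ i)).trans (Nat.le_succ _)) (hc i)
  refine ⟨(∑ i, c i) * r, fun n => ?_⟩
  have hle : (MvPolynomial.restrictDegree (Fin r) k n).map g.toLinearMap ≤
      gradedDegreeLT 𝒜 ((∑ i, c i) * r * n + 1) := by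
    rw [MvPolynomial.restrictDegree, MvPolynomial.restrictSupport_eq_span, Submodule.map_span,
      Submodule.span_le]
    rintro _ ⟨_, ⟨m, hm, rfl⟩, rfl⟩
    change g (MvPolynomial.monomial m 1) ∈ _
    rw [MvPolynomial.monomial_eq, map_one, one_mul, Finsupp.prod_fintype _ _ fun i => pow_zero _,
      map_prod]
    simp only [map_pow]
    have := prod_mem_gradedDegreeLT 𝒜 Finset.univ (m := (∑ i, c i) * n)
      (x := fun i => g (MvPolynomial.X i) ^ m i) fun i _ =>
        gradedDegreeLT_mono 𝒜 (Nat.succ_le_succ (Nat.mul_le_mul_left _ (hm i)))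
          (pow_mem_gradedDegreeLT 𝒜 (hc' i) (m i))
    rwa [Finset.card_univ, Fintype.card_fin, mul_right_comm] at this
  have := finite_gradedDegreeLT hfin ((∑ i, c i) * r * n + 1)
  rw [← finrank_gradedDegreeLT 𝒜 hfin, ← MvPolynomial.finrank_restrictDegree k r n,
    (Submodule.equivMapOfInjective g.toLinearMap hg _).finrank_eq]
  exact Submodule.finrank_mono hle

/-- A graded algebra that is finite over a polynomial algebra on `r` variables has growth of order
at most `r`. -/
theorem exists_sum_hilbertFunction_le_pow {r : ℕ} (g : MvPolynomial (Fin r) k →ₐ[k] A)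
    (hg : g.Finite) {s : Finset A} {d : A → ℕ} (hs : ∀ a ∈ s, 0 < d a ∧ a ∈ 𝒜 (d a))
    (hadj : Algebra.adjoin (𝒜 0) (s : Set A) = ⊤) (hfin : ∀ n, Module.Finite k (𝒜 n)) :
    ∃ t e : ℕ, ∀ n : ℕ, ∑ i ∈ Finset.range n, hilbertFunction 𝒜 i ≤ t * (e * n + 1) ^ r := by
  classical
  let : Algebra (MvPolynomial (Fin r) k) A := g.toRingHom.toAlgebra
  have : Module.Finite (MvPolynomial (Fin r) k) A := hg
  obtain ⟨w, hw⟩ := Module.Finite.fg_top (R := MvPolynomial (Fin r) k) (M := A)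
  let φ : A → MvPolynomial (Fin r) k →ₗ[k] A := fun v => LinearMap.mulRight k v ∘ₗ g.toLinearMap
  let F : ℕ → Submodule k A := fun n =>
    ⨆ v : w, (MvPolynomial.restrictDegree (Fin r) k n).map (φ v)
  have hFmem : ∀ {n p v}, p ∈ MvPolynomial.restrictDegree (Fin r) k n → v ∈ w → g p * v ∈ F n :=
    fun {n p v} hp hv => Submodule.mem_iSup_of_mem (⟨v, hv⟩ : w) ⟨p, hp, rfl⟩
  have hFmono : Monotone F := fun m n h => iSup_mono fun v =>
    Submodule.map_mono (MvPolynomial.restrictDegree_mono h)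
  have hFex : ∀ y, ∃ n, y ∈ F n := by
    intro y
    obtain ⟨c, -, rfl⟩ := Submodule.mem_span_finset.1
      (show y ∈ Submodule.span (MvPolynomial (Fin r) k) (w : Set A) by rw [hw]; trivial)
    choose N hN using fun v => MvPolynomial.exists_mem_restrictDegree (c v)
    exact ⟨w.sup N, sum_mem fun v hv => hFmono (Finset.le_sup hv) (hFmem (hN v) hv)⟩
  obtain ⟨u, hu⟩ := Module.Finite.iff_fg.1 (hfin 0)
  choose N hN using hFex
  let e := (u ∪ Finset.image₂ (· * ·) s w).sup N
  have he : ∀ y ∈ u ∪ Finset.image₂ (· * ·) s w, y ∈ F e := fun y hy =>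
    hFmono (Finset.le_sup (f := N) hy) (hN y)
  have h0 : 𝒜 0 ≤ F e := by
    rw [← hu, Submodule.span_le]
    exact fun y hy => he y (Finset.mem_union_left _ hy)
  have hFmul : ∀ p n, p ∈ MvPolynomial.restrictDegree (Fin r) k n → ∀ y ∈ F e,
      g p * y ∈ F (n + e) := by
    intro p n hp y hy
    have : F e ≤ (F (n + e)).comap (LinearMap.mulLeft k (g p)) := by
      refine iSup_le fun v => ?_
      rintro _ ⟨q, hq, rfl⟩
      change g p * (g q * v) ∈ F (n + e)
      rw [← mul_assoc, ← map_mul]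
      exact hFmem (MvPolynomial.mul_mem_restrictDegree hp hq) v.2
    exact this hy
  have hsF : ∀ a ∈ s, ∀ n, ∀ y ∈ F n, a * y ∈ F (n + e) := by
    intro a ha n y hy
    have : F n ≤ (F (n + e)).comap (LinearMap.mulLeft k a) := by
      refine iSup_le fun v => ?_
      rintro _ ⟨q, hq, rfl⟩
      change a * (g q * v) ∈ F (n + e)
      rw [mul_left_comm]
      exact hFmul q n hq _ (he _ (Finset.mem_union_right _ (Finset.mem_image₂_of_mem ha v.2)))
    exact this hy
  have hgr : ∀ n, 𝒜 n ≤ F (e * (n + 1)) := by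
    intro n
    induction n using Nat.strong_induction_on with
    | _ n ih =>
      rcases Nat.eq_zero_or_pos n with rfl | hn
      · simpa using h0
      intro y hy
      obtain ⟨c, hc, rfl⟩ := exists_eq_sum_mul_of_mem_graded hs hadj hn hy
      refine sum_mem fun a ha => ?_
      obtain ⟨ha, han⟩ := Finset.mem_filter.1 ha
      have had := (hs a ha).1
      refine hFmono ?_ (hsF a ha _ _ (ih (n - d a) (by omega) (hc a)))
      rw [← Nat.mul_succ]
      exact Nat.mul_le_mul_left e (by omega)
  have hdeg : ∀ n, gradedDegreeLT 𝒜 n ≤ F (e * n) := fun n => iSup_le fun i =>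
    (hgr i).trans (hFmono (Nat.mul_le_mul_left e i.2))
  have hFrank : ∀ n, Module.finrank k (F n) ≤ w.card * (n + 1) ^ r := by
    intro n
    refine (Submodule.finrank_iSup_le _).trans ?_
    rw [← Fintype.card_coe, ← smul_eq_mul, ← Finset.card_univ]
    refine Finset.sum_le_card_nsmul _ _ _ fun v _ => ?_
    rw [← MvPolynomial.finrank_restrictDegree k r n]
    exact Submodule.finrank_map_le _ _
  refine ⟨w.card, e, fun n => ?_⟩
  rw [← finrank_gradedDegreeLT 𝒜 hfin]
  have : Module.Finite k (F (e * n)) := by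
    simp only [F]
    infer_instance
  exact (Submodule.finrank_mono (hdeg n)).trans (hFrank _)

end Growth

theorem eventually_of_eventually_mul_add {W : ℕ} (hW : 0 < W) {p : ℕ → Prop}
    (h : ∀ m < W, ∀ᶠ n in atTop, p (W * n + m)) : ∀ᶠ n in atTop, p n := by
  have h' : ∀ᶠ n in atTop, ∀ m ∈ Finset.range W, p (W * n + m) :=
    (Finset.eventually_all _).2 fun m hm => h m (Finset.mem_range.1 hm)
  filter_upwards [(Nat.tendsto_div_const_atTop hW.ne').eventually h'] with n hn
  have := hn (n % W) (Finset.mem_range.2 (Nat.mod_lt _ hW))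
  rwa [Nat.div_add_mod] at this

/-- A sequence whose partial sums grow at least like `n ^ (d + 1)` is not `o(n ^ d)`. -/
theorem not_isLittleO_pow_of_pow_le_sum {h : ℕ → ℕ} {c d : ℕ}
    (hc : ∀ n : ℕ, (n + 1) ^ (d + 1) ≤ ∑ i ∈ Finset.range (c * n + 1), h i) :
    ¬ (fun n : ℕ => (h n : ℝ)) =o[atTop] (fun n : ℕ => (n : ℝ) ^ d) := by
  intro ho
  have hc0 : 0 < c := by
    by_contra hc0
    obtain rfl : c = 0 := by omega
    have h1 := hc (h 0)
    have h2 : h 0 + 1 ≤ (h 0 + 1) ^ (d + 1) := Nat.le_self_pow (by omega) _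
    simp at h1
    omega
  have hsum := ho.sum_range (fun i => by positivity) (by
    refine tendsto_atTop_mono' (f₁ := fun n : ℕ => (n : ℝ) - 1) _ ?_
      (tendsto_atTop_add_const_right _ _ tendsto_natCast_atTop_atTop)
    filter_upwards [eventually_ge_atTop 1] with n hn
    obtain ⟨n, rfl⟩ := Nat.exists_eq_add_of_le' hn
    rw [Finset.sum_range_succ']
    have : (∑ i ∈ Finset.range n, (1 : ℝ)) ≤ ∑ i ∈ Finset.range n, ((i + 1 : ℕ) : ℝ) ^ d :=
      Finset.sum_le_sum fun i _ => one_le_pow₀ (by exact_mod_cast Nat.succ_le_succ (Nat.zero_le i))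
    have h0 : (0 : ℝ) ≤ (0 : ℝ) ^ d := by positivity
    simp at this ⊢
    linarith)
  have hε : (0 : ℝ) < 1 / (2 * ((c : ℝ) + 1) ^ (d + 1)) := by positivity
  have h1 := isLittleO_iff.1 hsum hε
  have ht : Tendsto (fun n => c * n + 1) atTop atTop :=
    tendsto_atTop_mono (fun n => (Nat.le_mul_of_pos_left n hc0).trans (Nat.le_succ _)) tendsto_id
  obtain ⟨n, hn⟩ := (ht.eventually h1).exists
  have hle : ∑ i ∈ Finset.range (c * n + 1), (i : ℝ) ^ d ≤
      ((c : ℝ) + 1) ^ (d + 1) * ((n : ℝ) + 1) ^ (d + 1) := by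
    have h2 : ∑ i ∈ Finset.range (c * n + 1), (i : ℝ) ^ d ≤
        (c * n + 1 : ℕ) • ((c * n + 1 : ℕ) : ℝ) ^ d := by
      refine (Finset.sum_le_card_nsmul _ _ _ fun i hi => ?_).trans (by rw [Finset.card_range])
      have := (Finset.mem_range.1 hi).le
      gcongr
    refine h2.trans ?_
    rw [nsmul_eq_mul, ← pow_succ', ← mul_pow]
    gcongr
    push_cast
    nlinarith [Nat.cast_nonneg (α := ℝ) c, Nat.cast_nonneg (α := ℝ) n]
  rw [Real.norm_of_nonneg (Finset.sum_nonneg fun i _ => by positivity),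
    Real.norm_of_nonneg (Finset.sum_nonneg fun i _ => by positivity)] at hn
  have h3 : ((n : ℝ) + 1) ^ (d + 1) ≤ ∑ i ∈ Finset.range (c * n + 1), (h i : ℝ) := by
    exact_mod_cast hc n
  have h4 : (0 : ℝ) < ((n : ℝ) + 1) ^ (d + 1) := by positivity
  have h5 := h3.trans (hn.trans (mul_le_mul_of_nonneg_left hle hε.le))
  have h6 : 1 / (2 * ((c : ℝ) + 1) ^ (d + 1)) *
      (((c : ℝ) + 1) ^ (d + 1) * ((n : ℝ) + 1) ^ (d + 1)) = ((n : ℝ) + 1) ^ (d + 1) / 2 := by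
    have : ((c : ℝ) + 1) ^ (d + 1) ≠ 0 := by positivity
    field_simp
  linarith

/-- If partial sums grow at most like `n ^ (d + 1)`, then no subsequence along a progression
dominates `n ^ (d + 1)`. -/
theorem not_isBigO_pow_succ_of_sum_le_pow {h : ℕ → ℕ} {t e d W : ℕ}
    (ht : ∀ n : ℕ, ∑ i ∈ Finset.range n, h i ≤ t * (e * n + 1) ^ (d + 1)) (hW : 0 < W) :
    ¬ (fun n : ℕ => (n : ℝ) ^ (d + 1)) =O[atTop] (fun n : ℕ => (h (W * n) : ℝ)) := by
  intro hO
  obtain ⟨C, hC0, hC⟩ := hO.exists_pos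
  rw [isBigOWith_iff] at hC
  obtain ⟨n₀, hn₀⟩ := eventually_atTop.1 hC
  set D : ℝ := C * (t * (e * (2 * W) + 1 : ℕ) ^ (d + 1)) with hD
  obtain ⟨n, hn⟩ := exists_nat_gt (max D (max n₀ 1))
  have hnD : D < n := (le_max_left _ _).trans_lt hn
  have hnn : n₀ ≤ n := by
    exact_mod_cast (((le_max_left _ _).trans (le_max_right _ _)).trans_lt hn).le
  have hn1 : 1 ≤ n := by
    have : (1 : ℝ) < n := ((le_max_right _ _).trans (le_max_right _ _)).trans_lt hn
    exact_mod_cast this.le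
  have hsub : ∑ i ∈ Finset.range n, h (W * (n + i)) ≤ ∑ i ∈ Finset.range (2 * W * n), h i := by
    rw [← Finset.sum_image (f := h) (g := fun i => W * (n + i)) (fun i _ j _ hij => by
      have := Nat.eq_of_mul_eq_mul_left hW hij
      omega)]
    refine Finset.sum_le_sum_of_subset fun i hi => ?_
    obtain ⟨j, hj, rfl⟩ := Finset.mem_image.1 hi
    have := Finset.mem_range.1 hj
    rw [Finset.mem_range, show 2 * W * n = W * (2 * n) by ring]
    exact Nat.mul_lt_mul_of_pos_left (by omega) hW
  have hlow : (n : ℝ) * (n : ℝ) ^ (d + 1) ≤ C * ∑ i ∈ Finset.range n, (h (W * (n + i)) : ℝ) := by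
    have : ∑ _i ∈ Finset.range n, (n : ℝ) ^ (d + 1) ≤
        ∑ i ∈ Finset.range n, C * (h (W * (n + i)) : ℝ) := by
      refine Finset.sum_le_sum fun i _ => ?_
      have h1 := hn₀ (n + i) (by omega)
      rw [Real.norm_of_nonneg (by positivity), Real.norm_of_nonneg (by positivity)] at h1
      refine le_trans ?_ h1
      gcongr
      omega
    rwa [Finset.sum_const, Finset.card_range, nsmul_eq_mul, ← Finset.mul_sum] at this
  have hup : ∑ i ∈ Finset.range n, (h (W * (n + i)) : ℝ) ≤
      t * (e * (2 * W) + 1 : ℕ) ^ (d + 1) * (n : ℝ) ^ (d + 1) := by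
    have h1 := hsub.trans (ht (2 * W * n))
    have h2 : t * (e * (2 * W * n) + 1) ^ (d + 1) ≤
        t * (e * (2 * W) + 1) ^ (d + 1) * n ^ (d + 1) := by
      rw [mul_assoc t, ← mul_pow]
      gcongr
      nlinarith
    exact_mod_cast h1.trans h2
  have hpos : (0 : ℝ) < (n : ℝ) ^ (d + 1) := by positivity
  have := hlow.trans (mul_le_mul_of_nonneg_left hup hC0.le)
  rw [← mul_assoc] at this
  exact absurd (le_of_mul_le_mul_right this hpos) (not_le.2 hnD)

theorem Polynomial.degree_le_of_eventually_eval_le {P Q : Polynomial ℝ} {C : ℝ} {n₀ : ℕ}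
    (h : ∀ᶠ t : ℕ in atTop, 0 ≤ P.eval ((n₀ + t : ℕ) : ℝ) ∧
      P.eval ((n₀ + t : ℕ) : ℝ) ≤ C * Q.eval (t : ℝ)) : P.degree ≤ Q.degree := by
  by_contra! hlt
  have hP0 : P ≠ 0 := Polynomial.ne_zero_of_degree_gt hlt
  set P' := Polynomial.taylor (n₀ : ℝ) P with hP'
  have hdeg : P'.degree = P.degree := Polynomial.degree_taylor _ _
  have hlo := (Polynomial.isLittleO_atTop_of_degree_lt Q P' (hdeg ▸ hlt)).const_mul_left C
  have h1 := (isLittleO_iff.1 hlo (show (0 : ℝ) < 1 / 2 by norm_num))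
  have h2 := Polynomial.eventually_atTop_not_isRoot P' fun h => hP0 <| by
    rwa [← Polynomial.degree_eq_bot, hdeg, Polynomial.degree_eq_bot] at h
  obtain ⟨t, ⟨h3, h4⟩, h5, h6⟩ :=
    (h.and (tendsto_natCast_atTop_atTop.eventually (h1.and h2))).exists
  have hev : P'.eval (t : ℝ) = P.eval ((n₀ + t : ℕ) : ℝ) := by
    rw [hP', Polynomial.taylor_eval, Nat.cast_add, add_comm]
  rw [hev, Real.norm_eq_abs, Real.norm_of_nonneg h3] at h5
  rw [Polynomial.IsRoot.def, hev] at h6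
  exact h6 (by linarith [le_abs_self (C * Q.eval (t : ℝ))])

/-- Comparison of an eventually quasi-polynomial sequence with the growth of its partial sums. -/
theorem isSharpBigO_and_degree_of_sum_bounds {h : ℕ → ℕ} {d W : ℕ} (hW : 0 < W)
    {Q : ℕ → Polynomial ℚ}
    (hQ : ∀ m < W, ∀ᶠ n : ℕ in atTop, (h (W * n + m) : ℚ) = (Q m).eval (n : ℚ))
    (hdom : ∀ m < W, ∃ C n₀ : ℕ, ∀ t, h (W * (n₀ + t) + m) ≤ C * h (W * t))
    (hup : ∃ t e : ℕ, ∀ n : ℕ, ∑ i ∈ Finset.range n, h i ≤ t * (e * n + 1) ^ (d + 1))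
    (hlow : ∃ c : ℕ, ∀ n : ℕ, (n + 1) ^ (d + 1) ≤ ∑ i ∈ Finset.range (c * n + 1), h i) :
    IsSharpBigO h d ∧ (Q 0).degree = (d : WithBot ℕ) ∧ ∀ m < W, (Q m).degree ≤ (Q 0).degree := by
  obtain ⟨t, e, hup⟩ := hup
  obtain ⟨c, hlow⟩ := hlow
  set R : ℕ → Polynomial ℝ := fun m => (Q m).map (algebraMap ℚ ℝ) with hR
  have hRdeg : ∀ m, (R m).degree = (Q m).degree := fun m => Polynomial.degree_map _ _
  have hRev : ∀ m < W, ∀ᶠ n : ℕ in atTop, (h (W * n + m) : ℝ) = (R m).eval (n : ℝ) := by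
    intro m hm
    filter_upwards [hQ m hm] with n hn
    have h1 := congrArg (algebraMap ℚ ℝ) hn
    rw [← Polynomial.eval_map_apply] at h1
    simpa only [map_natCast] using h1
  have hXd : ∀ j : ℕ, (Polynomial.X ^ j : Polynomial ℝ).degree = (j : WithBot ℕ) :=
    fun j => Polynomial.degree_X_pow j
  have hle : ∀ m < W, (R m).degree ≤ (R 0).degree := by
    intro m hm
    obtain ⟨C, n₀, hC⟩ := hdom m hm
    refine Polynomial.degree_le_of_eventually_eval_le (C := C) (n₀ := n₀) ?_
    have h1 := (tendsto_atTop_mono (fun t => Nat.le_add_left t n₀) tendsto_id).eventually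
      (hRev m hm)
    filter_upwards [h1, hRev 0 hW] with t h1 h2
    rw [← h1, ← h2]
    exact ⟨by positivity, by exact_mod_cast hC t⟩
  have hnot := not_isLittleO_pow_of_pow_le_sum hlow
  have hub : (R 0).degree ≤ d := by
    by_contra! hlt
    have hd : ((d + 1 : ℕ) : WithBot ℕ) ≤ (R 0).degree := by
      have hne := Polynomial.ne_zero_of_degree_gt hlt
      rw [Polynomial.degree_eq_natDegree hne] at hlt ⊢
      exact_mod_cast hlt
    refine not_isBigO_pow_succ_of_sum_le_pow hup hW ?_
    have h1 := (Polynomial.isBigO_atTop_of_degree_le (Polynomial.X ^ (d + 1)) (R 0)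
      (by rwa [hXd])).comp_tendsto tendsto_natCast_atTop_atTop
    refine h1.congr' (.of_forall fun n => by simp) ?_
    filter_upwards [hRev 0 hW] with n hn
    simpa using hn.symm
  have hpow : ∀ m n : ℕ, (n : ℝ) ^ d ≤ ((W * n + m : ℕ) : ℝ) ^ d := fun m n => by
    gcongr
    exact (Nat.le_mul_of_pos_left n hW).trans (Nat.le_add_right _ _)
  have hlb : (d : WithBot ℕ) ≤ (R 0).degree := by
    by_contra! hlt
    refine hnot (isLittleO_iff.2 fun ε hε => eventually_of_eventually_mul_add hW fun m hm => ?_)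
    have h1 := (Polynomial.isLittleO_atTop_of_degree_lt (R m) (Polynomial.X ^ d)
      (by rw [hXd]; exact (hle m hm).trans_lt hlt)).comp_tendsto tendsto_natCast_atTop_atTop
    filter_upwards [isLittleO_iff.1 h1 hε, hRev m hm] with n h2 h3
    simp only [Function.comp_apply, Polynomial.eval_pow, Polynomial.eval_X] at h2
    rw [h3]
    refine h2.trans (mul_le_mul_of_nonneg_left ?_ hε.le)
    rw [Real.norm_of_nonneg (by positivity), Real.norm_of_nonneg (by positivity)]
    exact hpow m n
  have hbig : (fun n : ℕ => (h n : ℝ)) =O[atTop] (fun n : ℕ => (n : ℝ) ^ d) := by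
    have hm : ∀ m : ℕ, ∃ C : ℝ, 0 < C ∧ (m < W → ∀ᶠ n : ℕ in atTop,
        (h (W * n + m) : ℝ) ≤ C * ((W * n + m : ℕ) : ℝ) ^ d) := by
      intro m
      by_cases hm : m < W
      · have h1 := (Polynomial.isBigO_atTop_of_degree_le (R m) (Polynomial.X ^ d)
          (by rw [hXd]; exact (hle m hm).trans hub)).comp_tendsto
            (tendsto_natCast_atTop_atTop (R := ℝ))
        obtain ⟨C, hC0, hC⟩ := h1.exists_pos
        refine ⟨C, hC0, fun _ => ?_⟩
        filter_upwards [isBigOWith_iff.1 hC, hRev m hm] with n h2 h3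
        simp only [Function.comp_apply, Polynomial.eval_pow, Polynomial.eval_X] at h2
        rw [Real.norm_of_nonneg (by positivity : (0 : ℝ) ≤ (n : ℝ) ^ d), ← h3,
          Real.norm_of_nonneg (by positivity)] at h2
        exact h2.trans (mul_le_mul_of_nonneg_left (hpow m n) hC0.le)
      · exact ⟨1, one_pos, fun h => absurd h hm⟩
    choose C hC0 hC using hm
    refine IsBigO.of_bound (∑ m ∈ Finset.range W, C m) (eventually_of_eventually_mul_add hW
      fun m hm => (hC m hm).mono fun n hn => ?_)
    rw [Real.norm_of_nonneg (by positivity), Real.norm_of_nonneg (by positivity)]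
    refine hn.trans (mul_le_mul_of_nonneg_right ?_ (by positivity))
    exact Finset.single_le_sum (f := C) (fun i _ => (hC0 i).le) (Finset.mem_range.2 hm)
  refine ⟨⟨hbig, hnot⟩, ?_, fun m hm => ?_⟩
  · rw [← hRdeg]
    exact le_antisymm hub hlb
  · rw [← hRdeg, ← hRdeg]
    exact hle m hm

theorem mainTheorem12 {k A : Type*} [Field k] [CommRing A] [Algebra k A]
    (𝒜 : ℕ → Submodule k A) [GradedAlgebra 𝒜]
    (hfg : Algebra.FiniteType k A)
    (h0 : Module.Finite k (𝒜 0))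
    (hdim : 0 < ringKrullDim A) :
    (∀ n : ℕ, Module.Finite k (𝒜 n)) ∧
    ∃ d : ℕ, ringKrullDim A = ((d + 1 : ℕ) : WithBot ℕ∞) ∧
      IsSharpBigO (hilbertFunction 𝒜) d ∧
      ∃ W : ℕ, 0 < W ∧ ∃ Q : ℕ → Polynomial ℚ,
        (∀ m < W, ∀ᶠ n : ℕ in atTop,
          (hilbertFunction 𝒜 (W * n + m) : ℚ) = (Q m).eval (n : ℚ)) ∧
        (Q 0).degree = (d : WithBot ℕ) ∧
        ∀ m < W, (Q m).degree ≤ (Q 0).degree := by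
  obtain ⟨s, deg, hs, hadj⟩ := exists_finset_pos_degree_adjoin_eq_top 𝒜 hfg
  have hfin := finite_graded_of_adjoin_eq_top hs hadj h0
  refine ⟨hfin, ?_⟩
  have : Nontrivial A := by
    by_contra hA
    rw [not_nontrivial_iff_subsingleton] at hA
    rw [ringKrullDim_eq_bot_of_subsingleton] at hdim
    exact not_lt_bot hdim
  obtain ⟨r, g, hginj, hgfin⟩ := exists_finite_inj_algHom_of_fg k A
  have hr : ringKrullDim A = (r : WithBot ℕ∞) := by
    let : Algebra (MvPolynomial (Fin r) k) A := g.toRingHom.toAlgebra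
    have : Module.Finite (MvPolynomial (Fin r) k) A := hgfin
    have : FaithfulSMul (MvPolynomial (Fin r) k) A :=
      (faithfulSMul_iff_algebraMap_injective _ _).2 hginj
    rw [ringKrullDim_eq_of_isIntegral_of_faithfulSMul (R := MvPolynomial (Fin r) k)]
    simp
  obtain ⟨d, rfl⟩ : ∃ d, r = d + 1 := by
    refine Nat.exists_eq_succ_of_ne_zero ?_
    rintro rfl
    simp [hr] at hdim
  set W := ∏ a ∈ s, deg a with hW
  have hW0 : 0 < W := Finset.prod_pos fun a ha => (hs a ha).1
  let b : s → A := fun a => a.1 ^ (W / deg a)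
  have hb : ∀ a, b a ∈ 𝒜 W := fun a => pow_prod_div_mem_graded hs a.2
  have hnoeth : IsNoetherian (Algebra.adjoin k (Set.range b)) A := by
    have := isNoetherian_adjoin_image_pow hfg h0 hadj (fun a => W / deg a) fun a ha =>
      Nat.div_pos (Nat.le_of_dvd hW0 (Finset.dvd_prod_of_mem deg ha)) (hs a ha).1
    rwa [Set.image_eq_range] at this
  have hpoly : ∀ m, ∃ p : Polynomial ℚ, m < W → ∀ᶠ n : ℕ in atTop,
      (hilbertFunction 𝒜 (W * n + m) : ℚ) = p.eval (n : ℚ) := by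
    intro m
    by_cases hm : m < W
    · obtain ⟨p, hp⟩ := exists_polynomial_hilbertFunction 𝒜 hb hm hfin
      exact ⟨p, fun _ => hp⟩
    · exact ⟨0, fun h => absurd h hm⟩
  choose Q hQ using hpoly
  obtain ⟨h1, h2, h3⟩ := isSharpBigO_and_degree_of_sum_bounds hW0 hQ
    (fun m hm => exists_hilbertFunction_le_mul 𝒜 hb hm hfin)
    (exists_sum_hilbertFunction_le_pow 𝒜 g hgfin hs hadj hfin)
    (exists_pow_le_sum_hilbertFunction 𝒜 g hginj hfin)
  exact ⟨d, hr, h1, W, hW0, Q, hQ, h2, h3⟩
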